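/- Let $D$ be a finite set. For a finite set $V$ work with polynomials over $\mathbb{R}$ in indeterminates $x_{v,a}$ ($v\in V$, $a\in D$). An instance of a $k$-CSP with domain $D$ and a collection $\mathcal R$ of $k$-ary relations over $D$ is a pair $(V,\mathcal C)$, where $V$ is a finite set and $\mathcal C$ is a nonempty finite multiset of constraints $(\sigma,R)$ with $\sigma:[k]\to V$ injective and $R\in\mathcal R$; $\mathbb{E}_{\sigma\in\mathcal C}$ is the average over the scopes of the constraints, and $V^{\underline k}$ is the set of injections $[k]\to V$. For $Q\subseteq[k]$, $b\in D^Q$ and an injection $\sigma:[k]\to V$ put $x^{\sigma,b}=\prod_{i\in Q}x_{\sigma(i),b_i}$. The instance is *$(t,\epsilon,d)$-concentrated* if for every $Q\in\binom{[k]}{t}$ and $b\in D^Q$ there is a degree-$d$ sum-of-squares proof of $$\Big(\mathbb{E}_{\sigma\in\mathcal C}x^{\sigma,b}-\mathbb{E}_{\sigma\in V^{\underline k}}x^{\sigma,b}\Big)^2\le\epsilon^2$$ from the axioms $\sum_{a}x_{v,a}^2=1$ ($v\in V$) and $x_{v,a}x_{v,a'}=0$ ($v\in V$, $a\ne a'$).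 Here a degree-$d$ sum-of-squares proof of $p\ge 0$ from axioms $g=0$ ($g\in\mathcal A$) is an identity $p=\sum_j s_j^2+\sum_j q_jg_j$ with $g_j\in\mathcal A$ and all $s_j^2$ and $q_jg_j$ of degree at most $d$. A *pseudo-distribution of degree $\ell$ consistent with $\mathcal P(V,D)$* is a linear functional $\mu=\tilde{\mathbb{E}}_\mu$ on polynomials such that $\tilde{\mathbb{E}}_\mu[1]=1$, $\tilde{\mathbb{E}}_\mu[p^2]\ge0$ whenever $2\deg p\le\ell$, and $\tilde{\mathbb{E}}_\mu[qg]=0$ whenever $\deg(qg)\le\ell$ and $g=0$ is one of the equations $x_{v,a}^2=x_{v,a}$, $x_{v,a}x_{v,a'}=0$ ($a\neq a'$), $\sum_{a}x_{v,a}=1$ of $\mathcal P(V,D)$ (only the values in degree at most $\ell$ are constrained). For $T\subseteq V$ and $\alpha\in D^T$ let $x_\alpha=\prod_{v\in T}x_{v,\alpha(v)}$; write $\alpha\sim\alpha(T,\mu)$ when $\alpha\in D^T$ is chosen with probability $\tilde{\mathbb{E}}_\mu[x_\alpha]$, and let $\mu|\alpha$ be the functional $p\mapsto\tilde{\mathbb{E}}_\mu[x_\alpha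 p]/\tilde{\mathbb{E}}_\mu[x_\alpha]$. For a functional $\eta$, let $\eta_{\sigma(Q)}$ be the function $b\mapsto\tilde{\mathbb{E}}_\eta[x^{\sigma,b}]$ on $D^Q$ and $\eta_v$ the function $a\mapsto\tilde{\mathbb{E}}_\eta[x_{v,a}]$ on $D$; for $\nu: D\to\mathbb{R}$ and $|Q|=t$, $\nu^t$ is the function $b\mapsto\prod_{i\in Q}\nu(b_i)$ on $D^Q$. **Theorem.** For every $\epsilon>0$, every $t\in\mathbb{N}$ and every finite $D$ there are $K,N\in\mathbb{N}$ such that for every finite set $V$ with $|V|\ge N$ there is a probability distribution $\mathcal T$ over the subsets of $V$ of size at most $K$ with the following property. For all $k,d\in\mathbb{N}$, every $k$-CSP with domain $D$, every instance $(V,\mathcal C)$ of it that is $(t,\epsilon,d)$-concentrated, every pseudo-distribution $\mu$ of degree $K+d$ consistent with $\mathcal P(V,D)$, and every $Q\in\binom{[k]}{t}$, $$\mathbb{E}_{T\sim\mathcal T,\ \alpha\sim\alpha(T,\mu)}\Big\|\mathbb{E}_{\sigma\in\mathcal C}(\mu|\alpha)_{\sigma(Q)}-\Big(\mathbb{E}_{v\in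 V}(\mu|\alpha)_v\Big)^t\Big\|_{\ell_1}\le 2|D|^t\epsilon .$$ -/

import Mathlib

open MvPolynomial

noncomputable section

namespace SoSCSP

/-- An instance on the variable set `V` of the `k`-CSP with domain `D` and collection of relations
`𝓡`: a multiset of constraints `(σ, R)`, with `σ : [k] → V` injective and `R ∈ 𝓡`. -/
structure CSPInstance (V D : Type*) (k : ℕ) (𝓡 : Set (Set (Fin k → D))) where
  constraints : Multiset ((Fin k ↪ V) × Set (Fin k → D))
  mem_relations : ∀ c ∈ constraints, c.2 ∈ 𝓡

/-- A degree-`d` sum-of-squares proof of `0 ≤ p` from the equations `g = 0`, `g ∈ 𝒜`: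
an identity `p = ∑ sⱼ² + ∑ qⱼ gⱼ` all of whose terms have degree at most `d`. -/
def SoSProof {W : Type*} (𝒜 : Set (MvPolynomial W ℝ)) (d : ℕ) (p : MvPolynomial W ℝ) : Prop :=
  ∃ (m n : ℕ) (s : Fin m → MvPolynomial W ℝ) (q g : Fin n → MvPolynomial W ℝ),
    (∀ j, (s j ^ 2).totalDegree ≤ d) ∧
    (∀ j, g j ∈ 𝒜) ∧
    (∀ j, (q j * g j).totalDegree ≤ d) ∧
    p = ∑ j, s j ^ 2 + ∑ j, q j * g j

/-- `∑ₐ x_{v,a}² = 1` for every `v`, and `x_{v,a} x_{v,a'} = 0` for every `v` and `a ≠ a'`. -/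
def sosAxioms (V D : Type*) [Fintype D] : Set (MvPolynomial (V × D) ℝ) :=
  {g | ∃ v : V, g = ∑ a : D, X (v, a) ^ 2 - 1} ∪
  {g | ∃ (v : V) (a a' : D), a ≠ a' ∧ g = X (v, a) * X (v, a')}

/-- The system saying that `x` is the indicator vector of an assignment `V → D`:
`x_{v,a}² = x_{v,a}`, `x_{v,a} x_{v,a'} = 0` for `a ≠ a'`, and `∑ₐ x_{v,a} = 1`. -/
def assignmentSystem (V D : Type*) [Fintype D] : Set (MvPolynomial (V × D) ℝ) :=
  {g | ∃ (v : V) (a : D), g = X (v, a) ^ 2 - X (v, a)} ∪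
  {g | ∃ (v : V) (a a' : D), a ≠ a' ∧ g = X (v, a) * X (v, a')} ∪
  {g | ∃ v : V, g = ∑ a : D, X (v, a) - 1}

/-- `μ` is (the pseudo-expectation operator of) a pseudo-distribution of degree `d` consistent with
the equations `g = 0`, `g ∈ 𝒜`. Only the values of `μ` on polynomials of degree at most `d` are
constrained; its values beyond degree `d` are an arbitrary linear extension. -/
structure IsPseudoDistribution {W : Type*} (𝒜 : Set (MvPolynomial W ℝ)) (d : ℕ)
    (μ : MvPolynomial W ℝ →ₗ[ℝ] ℝ) : Prop where
  map_one : μ 1 = 1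
  map_sq_nonneg : ∀ p, 2 * p.totalDegree ≤ d → 0 ≤ μ (p ^ 2)
  map_mul_eq_zero : ∀ g ∈ 𝒜, ∀ q, (q * g).totalDegree ≤ d → μ (q * g) = 0

/-- The monomial `∏_{i ∈ Q} x_{σ(i), bᵢ}`, i.e. the indicator of `x ∘ σ` agreeing with `b` on `Q`. -/
def scopeMonomial {V D : Type*} {k : ℕ} (σ : Fin k ↪ V) (Q : Finset (Fin k)) (b : Q → D) :
    MvPolynomial (V × D) ℝ :=
  ∏ i : Q, X (σ i, b i)

/-- The average of `scopeMonomial σ Q b` over the scopes `σ` of the constraints. -/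
def constraintAverage {V D : Type*} {k : ℕ} {𝓡 : Set (Set (Fin k → D))}
    (I : CSPInstance V D k 𝓡) (Q : Finset (Fin k)) (b : Q → D) : MvPolynomial (V × D) ℝ :=
  (Multiset.card I.constraints : ℝ)⁻¹ • (I.constraints.map fun c => scopeMonomial c.1 Q b).sum

/-- The average of `scopeMonomial σ Q b` over all `k`-tuples `σ` of distinct variables. -/
def tupleAverage (V : Type*) {D : Type*} [Fintype V] [DecidableEq V] {k : ℕ}
    (Q : Finset (Fin k)) (b : Q → D) : MvPolynomial (V × D) ℝ :=
  (Fintype.card (Fin k ↪ V) : ℝ)⁻¹ • ∑ σ : Fin k ↪ V, scopeMonomial σ Q b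

/-- `(t, ε, d)`-concentration: for all `Q` of size `t` and all `b ∈ D^Q`, there is a degree-`d`
sum-of-squares proof that the two averages above differ by at most `ε`, in squared form. -/
def Concentrated {V D : Type*} [Fintype V] [DecidableEq V] [Fintype D] {k : ℕ}
    {𝓡 : Set (Set (Fin k → D))} (I : CSPInstance V D k 𝓡) (t : ℕ) (ε : ℝ) (d : ℕ) : Prop :=
  ∀ Q : Finset (Fin k), Q.card = t → ∀ b : Q → D,
    SoSProof (sosAxioms V D) d (C (ε ^ 2) - (constraintAverage I Q b - tupleAverage V Q b) ^ 2)

/-- The monomial `∏_{v ∈ T} x_{v, α(v)}`, i.e. the indicator of `x` agreeing with `α` on `T`. -/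
def partialMonomial {V D : Type*} (T : Finset V) (α : T → D) : MvPolynomial (V × D) ℝ :=
  ∏ v : T, X (v.1, α v)

/-- The conditioned pseudo-distribution `μ|α`: `p ↦ μ(x_α p) / μ(x_α)` with
`x_α = partialMonomial T α`. It is meaningful when the probability `μ(x_α)` of `α` is nonzero. -/
def condition {V D : Type*} (μ : MvPolynomial (V × D) ℝ →ₗ[ℝ] ℝ) (T : Finset V) (α : T → D) :
    MvPolynomial (V × D) ℝ →ₗ[ℝ] ℝ :=
  (μ (partialMonomial T α))⁻¹ • (μ ∘ₗ LinearMap.mulLeft ℝ (partialMonomial T α))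

/-- The average over the constraints `(σ, R)` of the marginal `η_{σ(Q)}`, as a function on `D^Q`. -/
def averageMarginal {V D : Type*} {k : ℕ} {𝓡 : Set (Set (Fin k → D))}
    (I : CSPInstance V D k 𝓡) (η : MvPolynomial (V × D) ℝ →ₗ[ℝ] ℝ) (Q : Finset (Fin k))
    (b : Q → D) : ℝ :=
  (Multiset.card I.constraints : ℝ)⁻¹ *
    (I.constraints.map fun c => η (scopeMonomial c.1 Q b)).sum

/-- The average over all variables `v` of the marginal `η_v`, as a function on `D`. -/
def averageVariable {V D : Type*} [Fintype V] (η : MvPolynomial (V × D) ℝ →ₗ[ℝ] ℝ) (a : D) : ℝ :=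
  (Fintype.card V : ℝ)⁻¹ * ∑ v : V, η (X (v, a))

/-- The `ℓ₁` distance on `D^Q` between the average marginal over the constraints and the product
distribution of the average variable marginal. -/
def productDistance {V D : Type*} [Fintype V] [Fintype D] {k : ℕ} {𝓡 : Set (Set (Fin k → D))}
    (I : CSPInstance V D k 𝓡) (η : MvPolynomial (V × D) ℝ →ₗ[ℝ] ℝ) (Q : Finset (Fin k)) : ℝ :=
  ∑ b : Q → D, |averageMarginal I η Q b - ∏ i : Q, averageVariable η (b i)|

/-- The expectation of `F (μ|α)` where `T ∼ 𝒯` and then `α ∈ D^T` is sampled from the marginal of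
`μ` on `T`, i.e. has probability `μ (partialMonomial T α)`. -/
def conditioningExpectation {V D : Type*} [Fintype V] [DecidableEq V] [Fintype D] {K : ℕ}
    (𝒯 : PMF {T : Finset V // T.card ≤ K}) (μ : MvPolynomial (V × D) ℝ →ₗ[ℝ] ℝ)
    (F : (MvPolynomial (V × D) ℝ →ₗ[ℝ] ℝ) → ℝ) : ℝ :=
  ∑ T : {T : Finset V // T.card ≤ K}, (𝒯 T).toReal *
    ∑ α : T.1 → D, μ (partialMonomial T.1 α) * F (condition μ T.1 α)

end SoSCSP

end

/-! Let `S_a` be the fraction of variables with value `a` (`frequency V a`). For a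
pseudo-distribution `η` of sufficient degree, three comparisons lead from the averaged marginal at
`b` to the product of the averaged one-variable marginals. Soundness of sum-of-squares proofs turns
concentration into an error `ε` between the constraint average and the tuple average. The tuple
average differs from `η (∏ S_{b_i})` by at most the probability that `t` random variables collide,
which vanishes as `|V|` grows. Finally, by Cauchy–Schwarz, `η (∏ S_{b_i})` is within the sum of the
standard deviations of the `S_{b_i}` of `∏ η (S_{b_i})`.

Conditioning makes these deviations small by a potential argument. Sum the expected squares of the
conditional means of all `x_{u,a}`. Conditioning on one more variable `v` raises each term by at
least the expected squared covariance of `x_{v,a}` with `x_{u,a}`; averaged over `v`, the total gain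
is at least `|V|` times the expected sum over `a` of the squared variances of `S_a`. The potential
stays in `[0, |D||V|]`, so at a random time `j < r` while conditioning on random variables that sum
has mean at most `|D|/r`. The sets are random prefixes, so their law depends on `V` and the
constants only, not on `μ` or the instance.

The main carriers are `sq_add_covariance_sq_le`, `potential_add_le`, `exists_pmf_sum_mul_le`,
`abs_map_prod_frequency_sub_le` and `productDistance_le`. -/

namespace SoSCSP

/-! ### Cauchy–Schwarz and the values of monomials -/

section PseudoExpectation

variable {V D : Type*} [Fintype D] {ℓ : ℕ} {η : MvPolynomial (V × D) ℝ →ₗ[ℝ] ℝ}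

/-- The Cauchy–Schwarz inequality for pseudo-distributions. -/
theorem IsPseudoDistribution.map_mul_sq_le {W : Type*} {𝒜 : Set (MvPolynomial W ℝ)}
    {η : MvPolynomial W ℝ →ₗ[ℝ] ℝ} (hη : IsPseudoDistribution 𝒜 ℓ η) {p q : MvPolynomial W ℝ}
    (hp : 2 * p.totalDegree ≤ ℓ) (hq : 2 * q.totalDegree ≤ ℓ) :
    η (p * q) ^ 2 ≤ η (p ^ 2) * η (q ^ 2) := by
  have h : ∀ x : ℝ, 0 ≤ η (p ^ 2) * (x * x) + 2 * η (p * q) * x + η (q ^ 2) := by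
    intro x
    have h1 : 0 ≤ η ((x • p + q) ^ 2) := by
      apply hη.map_sq_nonneg
      have := totalDegree_add (x • p) q
      have := totalDegree_smul_le x p
      omega
    have h2 : (x • p + q) ^ 2 = (x * x) • p ^ 2 + (2 * x) • (p * q) + q ^ 2 := by
      simp only [smul_eq_C_mul, C_mul, show (C 2 : MvPolynomial W ℝ) = 2 from map_ofNat C 2]
      ring
    rw [h2] at h1
    simp only [map_add, map_smul, smul_eq_mul] at h1
    linarith
  have := discrim_le_zero h
  rw [discrim] at this
  linarith

theorem IsPseudoDistribution.sq_map_le {W : Type*} {𝒜 : Set (MvPolynomial W ℝ)}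
    {η : MvPolynomial W ℝ →ₗ[ℝ] ℝ} (hη : IsPseudoDistribution 𝒜 ℓ η) {p : MvPolynomial W ℝ}
    (hp : 2 * p.totalDegree ≤ ℓ) : η p ^ 2 ≤ η (p ^ 2) := by
  simpa [hη.map_one] using hη.map_mul_sq_le hp (q := 1) (by simp)

theorem totalDegree_prod_X_le {ι W : Type*} (s : Finset ι) (w : ι → W) :
    (∏ i ∈ s, X (w i) : MvPolynomial W ℝ).totalDegree ≤ s.card := by
  refine (totalDegree_finsetProd _ _).trans ?_
  simp

theorem totalDegree_sq_le {W : Type*} (p : MvPolynomial W ℝ) :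
    (p ^ 2).totalDegree ≤ 2 * p.totalDegree := totalDegree_pow p 2

theorem IsPseudoDistribution.map_mul_X_sq
    (hη : IsPseudoDistribution (assignmentSystem V D) ℓ η) (w : V × D) {p : MvPolynomial (V × D) ℝ}
    (hp : p.totalDegree + 2 ≤ ℓ) : η (p * X w ^ 2) = η (p * X w) := by
  rw [← sub_eq_zero, ← map_sub, ← mul_sub]
  refine hη.map_mul_eq_zero _ (Or.inl (Or.inl ⟨w.1, w.2, rfl⟩)) _ ?_
  have h1 := totalDegree_mul p (X w ^ 2 - X w)
  have h2 := totalDegree_sub (X w ^ 2) (X w : MvPolynomial (V × D) ℝ)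
  rw [totalDegree_X_pow, totalDegree_X] at h2
  simp only [Prod.mk.eta]
  omega

theorem IsPseudoDistribution.map_mul_X_mul_X
    (hη : IsPseudoDistribution (assignmentSystem V D) ℓ η) (v : V) {a b : D} (hab : a ≠ b)
    {p : MvPolynomial (V × D) ℝ} (hp : p.totalDegree + 2 ≤ ℓ) :
    η (p * (X (v, a) * X (v, b))) = 0 := by
  refine hη.map_mul_eq_zero _ (Or.inl (Or.inr ⟨v, a, b, hab, rfl⟩)) _ ?_
  have h1 := totalDegree_mul p (X (v, a) * X (v, b))
  have h2 := totalDegree_mul (X (v, a)) (X (v, b) : MvPolynomial (V × D) ℝ)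
  rw [totalDegree_X, totalDegree_X] at h2
  omega

theorem IsPseudoDistribution.sum_map_mul_X
    (hη : IsPseudoDistribution (assignmentSystem V D) ℓ η) (v : V)
    {p : MvPolynomial (V × D) ℝ} (hp : p.totalDegree + 1 ≤ ℓ) :
    ∑ a, η (p * X (v, a)) = η p := by
  have h : η (p * (∑ a : D, X (v, a) - 1)) = 0 := by
    refine hη.map_mul_eq_zero _ (Or.inr ⟨v, rfl⟩) _ ?_
    have h1 := totalDegree_mul p (∑ a : D, X (v, a) - 1)
    have h2 := totalDegree_sub (∑ a : D, X (v, a)) (1 : MvPolynomial (V × D) ℝ)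
    have h3 : (∑ a : D, X (v, a) : MvPolynomial (V × D) ℝ).totalDegree ≤ 1 :=
      totalDegree_finsetSum_le fun a _ => by rw [totalDegree_X]
    rw [totalDegree_one] at h2
    omega
  rwa [mul_sub, mul_one, map_sub, sub_eq_zero, Finset.mul_sum, map_sum] at h

theorem IsPseudoDistribution.map_mul_prod_sq {ι : Type*}
    (hη : IsPseudoDistribution (assignmentSystem V D) ℓ η) (s : Finset ι) (w : ι → V × D)
    {p : MvPolynomial (V × D) ℝ} (hp : p.totalDegree + 2 * s.card ≤ ℓ) :
    η (p * (∏ i ∈ s, X (w i)) ^ 2) = η (p * ∏ i ∈ s, X (w i)) := by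
  classical
  induction s using Finset.induction_on generalizing p with
  | empty => simp
  | insert i s hi ih =>
    rw [Finset.card_insert_of_notMem hi] at hp
    have hX := totalDegree_X (R := ℝ) (w i)
    have h1 := totalDegree_mul p (X (w i))
    have h2 := totalDegree_mul p ((∏ j ∈ s, X (w j)) ^ 2)
    have h3 := totalDegree_sq_le (∏ j ∈ s, X (w j) : MvPolynomial (V × D) ℝ)
    have h4 := totalDegree_prod_X_le s w
    rw [Finset.prod_insert hi, mul_pow, mul_left_comm, mul_comm, hη.map_mul_X_sq, mul_right_comm,
      ih, mul_assoc] <;> omega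

/-- A monomial may be replaced by its square, which makes the argument a square. This is why
conditioning preserves positivity. -/
theorem IsPseudoDistribution.map_sq_mul_prod_nonneg {ι : Type*}
    (hη : IsPseudoDistribution (assignmentSystem V D) ℓ η) (s : Finset ι) (w : ι → V × D)
    {p : MvPolynomial (V × D) ℝ} (hp : 2 * p.totalDegree + 2 * s.card ≤ ℓ) :
    0 ≤ η (p ^ 2 * ∏ i ∈ s, X (w i)) := by
  have h1 := totalDegree_sq_le p
  have h2 := totalDegree_mul p (∏ i ∈ s, X (w i))
  have h3 := totalDegree_prod_X_le s w
  rw [← hη.map_mul_prod_sq s w (by omega), ← mul_pow]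
  exact hη.map_sq_nonneg _ (by omega)

theorem IsPseudoDistribution.map_prod_nonneg {ι : Type*}
    (hη : IsPseudoDistribution (assignmentSystem V D) ℓ η) (s : Finset ι) (w : ι → V × D)
    (hs : 2 * s.card ≤ ℓ) : 0 ≤ η (∏ i ∈ s, X (w i)) := by
  simpa using hη.map_sq_mul_prod_nonneg s w (p := 1) (by simpa using hs)

theorem IsPseudoDistribution.map_prod_le_one {ι : Type*}
    (hη : IsPseudoDistribution (assignmentSystem V D) ℓ η) (s : Finset ι) (w : ι → V × D)
    (hs : 2 * s.card ≤ ℓ) : η (∏ i ∈ s, X (w i)) ≤ 1 := by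
  set m : MvPolynomial (V × D) ℝ := ∏ i ∈ s, X (w i) with hm
  have h1 := totalDegree_prod_X_le s w
  have h2 := totalDegree_sub 1 m
  rw [totalDegree_one] at h2
  rw [← hm] at h1
  -- Since `m` and `m ^ 2` have the same value, `η ((1 - m) ^ 2) = 1 - η m`.
  have h3 := hη.map_sq_nonneg (1 - m) (by omega)
  have h4 := hη.map_mul_prod_sq s w (p := 1) (by simpa using hs)
  rw [one_mul, one_mul, ← hm] at h4
  have h5 : (1 - m) ^ 2 = 1 - 2 • m + m ^ 2 := by rw [two_nsmul]; ring
  rw [h5, map_add, map_sub, map_nsmul, h4, hη.map_one, two_nsmul] at h3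
  linarith

theorem IsPseudoDistribution.map_X_nonneg
    (hη : IsPseudoDistribution (assignmentSystem V D) ℓ η) (w : V × D) (hℓ : 2 ≤ ℓ) :
    0 ≤ η (X w) := by
  simpa using hη.map_prod_nonneg {()} (fun _ => w) (by simpa using hℓ)

theorem IsPseudoDistribution.map_X_le_one
    (hη : IsPseudoDistribution (assignmentSystem V D) ℓ η) (w : V × D) (hℓ : 2 ≤ ℓ) :
    η (X w) ≤ 1 := by
  simpa using hη.map_prod_le_one {()} (fun _ => w) (by simpa using hℓ)

end PseudoExpectation

/-! ### Soundness of sum-of-squares proofs -/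

section SoSProof

variable {V D : Type*} [Fintype D] {ℓ : ℕ} {η : MvPolynomial (V × D) ℝ →ₗ[ℝ] ℝ}

/-- The axiom `∑ x² = 1` follows from `x² = x` and `∑ x = 1` with no loss of degree, so a degree-`d`
proof needs only degree `d` of `η`. -/
theorem IsPseudoDistribution.map_mul_eq_zero_of_mem_sosAxioms
    (hη : IsPseudoDistribution (assignmentSystem V D) ℓ η) {g q : MvPolynomial (V × D) ℝ}
    (hg : g ∈ sosAxioms V D) (hq : (q * g).totalDegree ≤ ℓ) : η (q * g) = 0 := by
  obtain ⟨v, rfl⟩ | ⟨v, a, a', haa, rfl⟩ := hg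
  · rcases isEmpty_or_nonempty D with hD | hD
    · refine hη.map_mul_eq_zero _ (Or.inr ⟨v, ?_⟩) q hq
      simp
    · rcases eq_or_ne q 0 with rfl | hq0
      · simp
      -- Only the product's degree is bounded a priori. Degrees add over a domain and the axiom
      -- contains `x_{v,a}²`, so no cancellation can hide a larger `q`.
      have hdeg : q.totalDegree + 2 ≤ ℓ := by
        classical
        obtain ⟨a⟩ := hD
        have hc : coeff (Finsupp.single (v, a) 2) (∑ a : D, X (v, a) ^ 2 - 1 : MvPolynomial (V × D) ℝ)
            = 1 := by
          rw [coeff_sub, coeff_sum, Finset.sum_eq_single a]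
          · have h0 : (0 : V × D →₀ ℕ) ≠ Finsupp.single (v, a) 2 :=
              (Finsupp.single_ne_zero.2 two_ne_zero).symm
            simp [coeff_X_pow, coeff_one, h0]
          · intro b _ hb
            simp [coeff_X_pow, Finsupp.single_left_inj, hb]
          · simp
        have h2 := le_totalDegree (mem_support_iff.2 (hc.trans_ne one_ne_zero))
        rw [Finsupp.sum_single_index rfl] at h2
        rw [totalDegree_mul_of_isDomain hq0 (by rintro h; simp [h] at hc)] at hq
        omega
      have h : q * (∑ a : D, X (v, a) ^ 2 - 1) = ∑ a : D, q * X (v, a) ^ 2 - q := by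
        rw [mul_sub, Finset.mul_sum, mul_one]
      rw [h, map_sub, map_sum, Finset.sum_congr rfl fun a _ => hη.map_mul_X_sq (v, a) hdeg,
        hη.sum_map_mul_X v (by omega), sub_self]
  · exact hη.map_mul_eq_zero _ (Or.inl (Or.inr ⟨v, a, a', haa, rfl⟩)) q hq

theorem IsPseudoDistribution.nonneg_of_sosProof
    (hη : IsPseudoDistribution (assignmentSystem V D) ℓ η) {d : ℕ} {p : MvPolynomial (V × D) ℝ}
    (hp : SoSProof (sosAxioms V D) d p) (hd : d ≤ ℓ) : 0 ≤ η p := by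
  obtain ⟨m, n, s, q, g, hs, hg, hqg, rfl⟩ := hp
  rw [map_add, map_sum, map_sum, Finset.sum_eq_zero (s := Finset.univ) (f := fun j => η (q j * g j)),
    add_zero]
  · refine Finset.sum_nonneg fun j _ => hη.map_sq_nonneg _ ((le_of_eq ?_).trans ((hs j).trans hd))
    rcases eq_or_ne (s j) 0 with h | h
    · simp [h]
    · rw [sq, totalDegree_mul_of_isDomain h h, two_mul]
  · exact fun j _ => hη.map_mul_eq_zero_of_mem_sosAxioms (hg j) ((hqg j).trans hd)

end SoSProof

/-! ### Conditioning on partial assignments -/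

section Condition

variable {V D : Type*} {ℓ ℓ' : ℕ} {μ η : MvPolynomial (V × D) ℝ →ₗ[ℝ] ℝ}

/-- The functional `p ↦ μ(m p) / μ(m)`. -/
noncomputable def conditionOn (μ : MvPolynomial (V × D) ℝ →ₗ[ℝ] ℝ) (m : MvPolynomial (V × D) ℝ) :
    MvPolynomial (V × D) ℝ →ₗ[ℝ] ℝ :=
  (μ m)⁻¹ • (μ ∘ₗ LinearMap.mulLeft ℝ m)

theorem conditionOn_apply (m p : MvPolynomial (V × D) ℝ) :
    conditionOn μ m p = (μ m)⁻¹ * μ (m * p) := rfl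

theorem condition_eq_conditionOn (T : Finset V) (α : T → D) :
    condition μ T α = conditionOn μ (partialMonomial T α) := rfl

theorem mul_conditionOn_apply {m p : MvPolynomial (V × D) ℝ} (hm : μ m ≠ 0) :
    μ m * conditionOn μ m p = μ (m * p) := by
  rw [conditionOn_apply, mul_inv_cancel_left₀ hm]

theorem conditionOn_conditionOn {m : MvPolynomial (V × D) ℝ} (hm : μ m ≠ 0)
    (q : MvPolynomial (V × D) ℝ) :
    conditionOn (conditionOn μ m) q = conditionOn μ (m * q) := by
  refine LinearMap.ext fun p => ?_
  rw [conditionOn_apply, conditionOn_apply, conditionOn_apply, conditionOn_apply, mul_inv, inv_inv,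
    mul_assoc, mul_assoc]
  field_simp

theorem totalDegree_partialMonomial_le (T : Finset V) (α : T → D) :
    (partialMonomial T α).totalDegree ≤ T.card :=
  (totalDegree_prod_X_le Finset.univ fun v : T => (v.1, α v)).trans (by simp)

variable [DecidableEq V]

theorem partialMonomial_insert {T : Finset V} {v : V} (hv : v ∉ T)
    (α : (↥(insert v T)) → D) :
    partialMonomial (insert v T) α = partialMonomial T (fun u => α ⟨u, Finset.mem_insert_of_mem u.2⟩) *
      X (v, α ⟨v, Finset.mem_insert_self v T⟩) := by
  rw [partialMonomial, partialMonomial, ← (Finset.subtypeInsertEquivOption hv).symm.prod_comp,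
    Fintype.prod_option, mul_comm]
  rfl

variable [Fintype D]

theorem sum_partialMonomial_insert {T : Finset V} {v : V} (hv : v ∉ T)
    {M : Type*} [AddCommMonoid M] (F : MvPolynomial (V × D) ℝ → M) :
    ∑ α : (↥(insert v T)) → D, F (partialMonomial (insert v T) α) =
      ∑ α : T → D, ∑ c, F (partialMonomial T α * X (v, c)) := by
  rw [← Fintype.sum_prod_type' (f := fun (α : T → D) c => F (partialMonomial T α * X (v, c)))]
  refine Fintype.sum_equiv (((Finset.subtypeInsertEquivOption hv).arrowCongr (Equiv.refl D)).trans
    (Equiv.piOptionEquivProd.trans (Equiv.prodComm _ _))) _ _ fun α => ?_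
  rw [partialMonomial_insert hv]
  rfl

variable (hμ : IsPseudoDistribution (assignmentSystem V D) ℓ μ)
include hμ

omit [DecidableEq V] in
theorem IsPseudoDistribution.map_partialMonomial_nonneg {T : Finset V} (hT : 2 * T.card ≤ ℓ)
    (α : T → D) : 0 ≤ μ (partialMonomial T α) :=
  hμ.map_prod_nonneg Finset.univ (fun v : T => (v.1, α v)) (by simpa using hT)

theorem IsPseudoDistribution.sum_map_partialMonomial {T : Finset V} (hT : 2 * T.card ≤ ℓ) :
    ∑ α : T → D, μ (partialMonomial T α) = 1 := by
  induction T using Finset.induction_on with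
  | empty => simp [partialMonomial, hμ.map_one]
  | insert v T hv ih =>
    rw [Finset.card_insert_of_notMem hv] at hT
    rw [sum_partialMonomial_insert hv (fun m => μ m), ← ih (by omega)]
    refine Finset.sum_congr rfl fun α _ => hμ.sum_map_mul_X v ?_
    have := totalDegree_partialMonomial_le T α
    omega

omit [DecidableEq V] in
theorem IsPseudoDistribution.condition {T : Finset V} {α : T → D} (hT : ℓ' + 2 * T.card ≤ ℓ)
    (hα : μ (partialMonomial T α) ≠ 0) :
    IsPseudoDistribution (assignmentSystem V D) ℓ' (condition μ T α) := by
  have hdeg := totalDegree_partialMonomial_le T α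
  refine ⟨?_, fun p hp => ?_, fun g hg q hq => ?_⟩
  · rw [condition_eq_conditionOn, conditionOn_apply, mul_one, inv_mul_cancel₀ hα]
  · refine mul_nonneg (inv_nonneg.2 (hμ.map_partialMonomial_nonneg (by omega) α)) ?_
    rw [LinearMap.comp_apply, LinearMap.mulLeft_apply, mul_comm]
    refine hμ.map_sq_mul_prod_nonneg Finset.univ (fun v : T => (v.1, α v)) ?_
    simp only [Finset.card_univ, Fintype.card_coe]
    omega
  · have := totalDegree_mul (partialMonomial T α) (q * g)
    rw [condition_eq_conditionOn, conditionOn_apply, ← mul_assoc, hμ.map_mul_eq_zero g hg, mul_zero]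
    rw [mul_assoc]
    omega

omit hμ

/-- The expectation of `F (μ|α)` where `α ∈ D^T` is sampled from the marginal of `μ` on `T`. -/
noncomputable def expectCondition (μ : MvPolynomial (V × D) ℝ →ₗ[ℝ] ℝ) (T : Finset V)
    (F : (MvPolynomial (V × D) ℝ →ₗ[ℝ] ℝ) → ℝ) : ℝ :=
  ∑ α : T → D, μ (partialMonomial T α) * F (SoSCSP.condition μ T α)

include hμ

/-- Outcomes of probability zero have weight zero, so only genuine pseudo-distributions need
comparing; conditioning on `T` costs `2|T|` degrees. -/
theorem IsPseudoDistribution.expectCondition_le {T : Finset V} (hT : ℓ' + 2 * T.card ≤ ℓ)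
    {F G : (MvPolynomial (V × D) ℝ →ₗ[ℝ] ℝ) → ℝ}
    (hFG : ∀ η, IsPseudoDistribution (assignmentSystem V D) ℓ' η → F η ≤ G η) :
    expectCondition μ T F ≤ expectCondition μ T G := by
  refine Finset.sum_le_sum fun α _ => ?_
  rcases eq_or_ne (μ (partialMonomial T α)) 0 with h | h
  · simp [h]
  · exact mul_le_mul_of_nonneg_left (hFG _ (hμ.condition hT h))
      (hμ.map_partialMonomial_nonneg (by omega) α)

theorem IsPseudoDistribution.expectCondition_const {T : Finset V} (hT : 2 * T.card ≤ ℓ) (c : ℝ) :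
    expectCondition μ T (fun _ => c) = c := by
  rw [expectCondition, ← Finset.sum_mul, hμ.sum_map_partialMonomial hT, one_mul]

omit hμ

theorem expectCondition_add (T : Finset V) (F G : (MvPolynomial (V × D) ℝ →ₗ[ℝ] ℝ) → ℝ) :
    expectCondition μ T (fun η => F η + G η) = expectCondition μ T F + expectCondition μ T G := by
  simp only [expectCondition, mul_add, Finset.sum_add_distrib]

theorem expectCondition_const_mul (T : Finset V) (c : ℝ)
    (F : (MvPolynomial (V × D) ℝ →ₗ[ℝ] ℝ) → ℝ) :
    expectCondition μ T (fun η => c * F η) = c * expectCondition μ T F := by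
  simp only [expectCondition, Finset.mul_sum, mul_left_comm]

theorem expectCondition_sum {ι : Type*} (s : Finset ι) (T : Finset V)
    (F : ι → (MvPolynomial (V × D) ℝ →ₗ[ℝ] ℝ) → ℝ) :
    expectCondition μ T (fun η => ∑ i ∈ s, F i η) = ∑ i ∈ s, expectCondition μ T (F i) := by
  simp only [expectCondition, Finset.mul_sum]
  exact Finset.sum_comm

include hμ

/-- Sampling the value of one more variable amounts to conditioning on it. -/
theorem IsPseudoDistribution.expectCondition_insert {T : Finset V} {v : V}
    (hv : v ∉ T) (hT : 2 * T.card + 2 ≤ ℓ) (F : (MvPolynomial (V × D) ℝ →ₗ[ℝ] ℝ) → ℝ) :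
    expectCondition μ (insert v T) F =
      expectCondition μ T fun η => ∑ c, η (X (v, c)) * F (conditionOn η (X (v, c))) := by
  simp only [expectCondition, condition_eq_conditionOn, Finset.mul_sum]
  rw [sum_partialMonomial_insert hv (fun m => μ m * F (conditionOn μ m))]
  refine Finset.sum_congr rfl fun α _ => Finset.sum_congr rfl fun c _ => ?_
  -- If `α` has probability zero, Cauchy–Schwarz gives every extension of it probability zero too,
  -- so the meaningless conditioned functional never counts.
  rcases eq_or_ne (μ (partialMonomial T α)) 0 with h | h
  · rw [h, zero_mul]
    have h1 : μ (partialMonomial T α * X (v, c)) = 0 := by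
      have h2 := hμ.map_mul_sq_le (p := partialMonomial T α) (q := X (v, c))
        (by have := totalDegree_partialMonomial_le T α; omega) (by rw [totalDegree_X]; omega)
      have h3 := hμ.map_mul_prod_sq Finset.univ (fun v : T => (v.1, α v)) (p := 1)
        (by simp; omega)
      rw [one_mul, one_mul] at h3
      rw [show μ (partialMonomial T α ^ 2) = μ (partialMonomial T α) from h3, h, zero_mul] at h2
      exact pow_eq_zero_iff two_ne_zero |>.1 (le_antisymm h2 (sq_nonneg _))
    rw [h1, zero_mul]
  · rw [conditionOn_conditionOn h, ← mul_assoc, mul_conditionOn_apply h]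

end Condition

/-! ### Gain in squared means from conditioning on one variable -/

section Covariance

variable {V D : Type*} {ℓ : ℕ} {μ η : MvPolynomial (V × D) ℝ →ₗ[ℝ] ℝ}

/-- The covariance of `p` and `q` under `η`. -/
noncomputable def covariance (η : MvPolynomial (V × D) ℝ →ₗ[ℝ] ℝ) (p q : MvPolynomial (V × D) ℝ) : ℝ :=
  η (p * q) - η p * η q

variable [Fintype D]

/-- The right side minus `η (X w) ^ 2` is the variance of the conditional mean `r c` of `X w` given
the value `c` of `v`. Its term at `b` is `p b * (r b - y) ^ 2`, which dominates the squared
covariance `(p b * (r b - y)) ^ 2` because `p b ≤ 1`. -/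
theorem IsPseudoDistribution.sq_add_covariance_sq_le
    (hη : IsPseudoDistribution (assignmentSystem V D) ℓ η) (hℓ : 4 ≤ ℓ) (v : V) (b : D)
    (w : V × D) :
    η (X w) ^ 2 + covariance η (X (v, b)) (X w) ^ 2 ≤
      ∑ c, η (X (v, c)) * conditionOn η (X (v, c)) (X w) ^ 2 := by
  set p : D → ℝ := fun c => η (X (v, c)) with hp
  set r : D → ℝ := fun c => conditionOn η (X (v, c)) (X w) with hr
  set y : ℝ := η (X w) with hy
  have hp0 : ∀ c, 0 ≤ p c := fun c => hη.map_X_nonneg _ (by omega)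
  have hp1 : ∀ c, p c ≤ 1 := fun c => hη.map_X_le_one _ (by omega)
  have hz : ∀ c, η (X (v, c) * X w) = p c * r c := by
    intro c
    rcases eq_or_ne (p c) 0 with h | h
    · have h1 := hη.map_mul_sq_le (p := X (v, c)) (q := X w) (by rw [totalDegree_X]; omega)
        (by rw [totalDegree_X]; omega)
      have h2 := hη.map_mul_X_sq (v, c) (p := 1) (by rw [totalDegree_one]; omega)
      rw [one_mul, one_mul] at h2
      rw [h2, show η (X (v, c)) = 0 from h, zero_mul] at h1
      rw [h, zero_mul]
      exact pow_eq_zero_iff two_ne_zero |>.1 (le_antisymm h1 (sq_nonneg _))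
    · exact (mul_conditionOn_apply h).symm
  have hsp : ∑ c, p c = 1 := by
    have := hη.sum_map_mul_X v (p := 1) (by rw [totalDegree_one]; omega)
    simpa [hη.map_one] using this
  have hsz : ∑ c, p c * r c = y := by
    rw [hy, ← hη.sum_map_mul_X v (p := X w) (by rw [totalDegree_X]; omega)]
    exact Finset.sum_congr rfl fun c _ => by rw [← hz, mul_comm]
  have hvar : ∑ c, p c * (r c - y) ^ 2 = ∑ c, p c * r c ^ 2 - y ^ 2 := by
    calc ∑ c, p c * (r c - y) ^ 2
        = ∑ c, (p c * r c ^ 2 - 2 * y * (p c * r c) + y ^ 2 * p c) :=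
          Finset.sum_congr rfl fun c _ => by ring
      _ = ∑ c, p c * r c ^ 2 - y ^ 2 := by
          rw [Finset.sum_add_distrib, Finset.sum_sub_distrib, ← Finset.mul_sum, ← Finset.mul_sum,
            hsp, hsz]
          ring
  have hb : p b * (r b - y) ^ 2 ≤ ∑ c, p c * (r c - y) ^ 2 :=
    Finset.single_le_sum (f := fun c => p c * (r c - y) ^ 2)
      (fun c _ => mul_nonneg (hp0 c) (sq_nonneg _)) (Finset.mem_univ b)
  have hcov : covariance η (X (v, b)) (X w) = p b * (r b - y) := by
    rw [covariance, hz]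
    ring
  have hle : (p b * (r b - y)) ^ 2 ≤ p b * (r b - y) ^ 2 := by
    rw [mul_pow]
    exact mul_le_mul_of_nonneg_right (by nlinarith [hp0 b, hp1 b]) (sq_nonneg _)
  rw [hcov]
  linarith

variable [DecidableEq V]

open scoped Classical in
/-- Conditioning fixes the values of the variables that it samples. -/
theorem IsPseudoDistribution.map_partialMonomial_mul_X
    (hμ : IsPseudoDistribution (assignmentSystem V D) ℓ μ) {T : Finset V} {v : V} (hv : v ∈ T)
    (α : T → D) (b : D) {p : MvPolynomial (V × D) ℝ} (hp : T.card + 1 + p.totalDegree ≤ ℓ) :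
    μ (partialMonomial T α * (X (v, b) * p)) =
      if b = α ⟨v, hv⟩ then μ (partialMonomial T α * p) else 0 := by
  have h1 : partialMonomial T α =
      (∏ u ∈ Finset.univ.erase (⟨v, hv⟩ : T), X (u.1, α u)) * X (v, α ⟨v, hv⟩) :=
    (Finset.prod_erase_mul Finset.univ (fun u : T => (X (u.1, α u) : MvPolynomial (V × D) ℝ))
      (Finset.mem_univ (⟨v, hv⟩ : T))).symm
  set R : MvPolynomial (V × D) ℝ := ∏ u ∈ Finset.univ.erase (⟨v, hv⟩ : T), X (u.1, α u) with hR
  have h2 : R.totalDegree ≤ T.card - 1 := by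
    refine (totalDegree_prod_X_le _ fun u : T => (u.1, α u)).trans ?_
    rw [Finset.card_erase_of_mem (Finset.mem_univ _), Finset.card_univ, Fintype.card_coe]
  have h3 := totalDegree_mul R p
  have h4 := Finset.card_pos.2 ⟨v, hv⟩
  rw [h1]
  split_ifs with hb
  · rw [← hb, mul_right_comm R _ p, ← hμ.map_mul_X_sq (v, b) (p := R * p) (by omega)]
    congr 1
    ring
  · rw [← hμ.map_mul_X_mul_X v (Ne.symm hb) (p := R * p) (by omega)]
    congr 1
    ring

/-- After conditioning on `T ∋ v`, the variable `x_{v,b}` acts as the constant 0 or 1. Drawing a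
variable already in `T` therefore gains nothing but also has nothing to gain. -/
theorem IsPseudoDistribution.covariance_condition_eq_zero
    (hμ : IsPseudoDistribution (assignmentSystem V D) ℓ μ) {T : Finset V} {v : V} (hv : v ∈ T)
    {α : T → D} (hα : μ (partialMonomial T α) ≠ 0) (b : D) {p : MvPolynomial (V × D) ℝ}
    (hp : T.card + 1 + p.totalDegree ≤ ℓ) :
    covariance (SoSCSP.condition μ T α) (X (v, b)) p = 0 := by
  have h := hμ.map_partialMonomial_mul_X hv α b (p := 1) (by rw [totalDegree_one]; omega)
  rw [mul_one, mul_one] at h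
  rw [covariance, condition_eq_conditionOn, conditionOn_apply, conditionOn_apply,
    conditionOn_apply, hμ.map_partialMonomial_mul_X hv α b hp, h]
  split_ifs
  · rw [inv_mul_cancel₀ hα, one_mul, sub_self]
  · ring

theorem IsPseudoDistribution.expectCondition_sq_add_covariance_sq_le
    (hμ : IsPseudoDistribution (assignmentSystem V D) ℓ μ) {T : Finset V}
    (hT : 2 * T.card + 4 ≤ ℓ) (v : V) (b : D) (w : V × D) :
    expectCondition μ T (fun η => η (X w) ^ 2) +
        expectCondition μ T (fun η => covariance η (X (v, b)) (X w) ^ 2) ≤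
      expectCondition μ (insert v T) (fun η => η (X w) ^ 2) := by
  by_cases hv : v ∈ T
  · have h : expectCondition μ T (fun η => covariance η (X (v, b)) (X w) ^ 2) = 0 := by
      refine Finset.sum_eq_zero fun α _ => ?_
      rcases eq_or_ne (μ (partialMonomial T α)) 0 with h | h
      · rw [h, zero_mul]
      · have := hμ.covariance_condition_eq_zero hv h b (p := X w) (by rw [totalDegree_X]; omega)
        simp [this]
    rw [h, add_zero, Finset.insert_eq_of_mem hv]
  · rw [hμ.expectCondition_insert hv (by omega), ← expectCondition_add]
    exact hμ.expectCondition_le (ℓ' := 4) (by omega) fun η hη =>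
      hη.sq_add_covariance_sq_le le_rfl v b w

end Covariance

/-! ### The potential and its growth -/

section Potential

variable {V D : Type*} [Fintype V] {ℓ : ℕ} {μ η : MvPolynomial (V × D) ℝ →ₗ[ℝ] ℝ}

/-- The fraction of the variables that have value `a`. -/
noncomputable def frequency (V : Type*) {D : Type*} [Fintype V] (a : D) :
    MvPolynomial (V × D) ℝ :=
  (Fintype.card V : ℝ)⁻¹ • ∑ v : V, X (v, a)

theorem averageVariable_eq (a : D) : averageVariable η a = η (frequency V a) := by
  rw [frequency, map_smul, map_sum, smul_eq_mul, averageVariable]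

theorem sum_covariance (a : D) :
    ∑ v, ∑ u, covariance η (X (v, a)) (X (u, a)) =
      (Fintype.card V : ℝ) ^ 2 * covariance η (frequency V a) (frequency V a) := by
  have h : ∑ v, ∑ u, covariance η (X (v, a)) (X (u, a)) =
      covariance η (∑ v : V, X (v, a)) (∑ v : V, X (v, a)) := by
    simp only [covariance, Finset.sum_sub_distrib, map_sum, Finset.sum_mul_sum]
  rcases eq_or_ne (Fintype.card V : ℝ) 0 with h0 | h0
  · have : IsEmpty V := Fintype.card_eq_zero_iff.1 (by exact_mod_cast h0)
    simp
  · rw [h, covariance, covariance, frequency, smul_mul_smul_comm, map_smul, map_smul, smul_eq_mul,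
      smul_eq_mul]
    field_simp

theorem card_sq_mul_covariance_sq_le (a : D) :
    (Fintype.card V : ℝ) ^ 2 * covariance η (frequency V a) (frequency V a) ^ 2 ≤
      ∑ v, ∑ u, covariance η (X (v, a)) (X (u, a)) ^ 2 := by
  -- Cauchy–Schwarz over the `|V|²` pairs: the variance of the frequency is the average of the
  -- pairwise covariances.
  have h := sq_sum_le_card_mul_sum_sq (s := (Finset.univ : Finset (V × V)))
    (f := fun x => covariance η (X (x.1, a)) (X (x.2, a)))
  rw [Fintype.sum_prod_type, Fintype.sum_prod_type, sum_covariance, Finset.card_univ,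
    Fintype.card_prod, Nat.cast_mul, ← sq] at h
  rcases eq_or_ne (Fintype.card V : ℝ) 0 with h0 | h0
  · rw [h0]
    simp only [ne_eq, OfNat.ofNat_ne_zero, not_false_eq_true, zero_pow, zero_mul]
    positivity
  · have : 0 < (Fintype.card V : ℝ) ^ 2 := by positivity
    refine le_of_mul_le_mul_left (le_trans (le_of_eq ?_) h) this
    ring

variable [Fintype D] [DecidableEq V]

/-- The sum over all `x_{u,a}` of the expected square of their mean after conditioning on `T`. -/
noncomputable def potential (μ : MvPolynomial (V × D) ℝ →ₗ[ℝ] ℝ) (T : Finset V) : ℝ :=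
  ∑ a : D, ∑ u : V, expectCondition μ T fun η => η (X (u, a)) ^ 2

/-- The expected total of the squared variances of the frequencies after conditioning on `T`. -/
noncomputable def expectedVarianceSq (μ : MvPolynomial (V × D) ℝ →ₗ[ℝ] ℝ) (T : Finset V) : ℝ :=
  expectCondition μ T fun η => ∑ a : D, covariance η (frequency V a) (frequency V a) ^ 2

variable (hμ : IsPseudoDistribution (assignmentSystem V D) ℓ μ)
include hμ

theorem IsPseudoDistribution.potential_add_le {T : Finset V} (hT : 2 * T.card + 4 ≤ ℓ) :
    (Fintype.card V : ℝ) * potential μ T + (Fintype.card V : ℝ) ^ 2 * expectedVarianceSq μ T ≤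
      ∑ v, potential μ (insert v T) := by
  have h1 : (Fintype.card V : ℝ) * potential μ T = ∑ _v : V, potential μ T := by
    rw [Finset.sum_const, Finset.card_univ, nsmul_eq_mul]
  have h2 : (Fintype.card V : ℝ) ^ 2 * expectedVarianceSq μ T ≤ ∑ v : V, ∑ a : D, ∑ u : V,
      expectCondition μ T fun η => covariance η (X (v, a)) (X (u, a)) ^ 2 := by
    rw [expectedVarianceSq, ← expectCondition_const_mul]
    simp only [← expectCondition_sum]
    refine hμ.expectCondition_le (ℓ' := 4) (by omega) fun η _ => ?_
    rw [Finset.mul_sum, Finset.sum_comm]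
    exact Finset.sum_le_sum fun a _ => card_sq_mul_covariance_sq_le a
  rw [h1]
  refine (add_le_add_right h2 _).trans ?_
  rw [← Finset.sum_add_distrib]
  refine Finset.sum_le_sum fun v _ => ?_
  rw [potential, ← Finset.sum_add_distrib]
  refine Finset.sum_le_sum fun a _ => ?_
  rw [← Finset.sum_add_distrib]
  exact Finset.sum_le_sum fun u _ => hμ.expectCondition_sq_add_covariance_sq_le hT v a (u, a)

theorem IsPseudoDistribution.potential_nonneg {T : Finset V} (hT : 2 * T.card ≤ ℓ) :
    0 ≤ potential μ T := by
  refine Finset.sum_nonneg fun a _ => Finset.sum_nonneg fun u _ => Finset.sum_nonneg fun α _ => ?_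
  exact mul_nonneg (hμ.map_partialMonomial_nonneg hT α) (sq_nonneg _)

theorem IsPseudoDistribution.potential_le {T : Finset V} (hT : 2 * T.card + 2 ≤ ℓ) :
    potential μ T ≤ Fintype.card D * Fintype.card V := by
  have h : ∀ (a : D) (u : V), expectCondition μ T (fun η => η (X (u, a)) ^ 2) ≤ 1 := by
    intro a u
    rw [← hμ.expectCondition_const (T := T) (by omega) 1]
    refine hμ.expectCondition_le (ℓ' := 2) (by omega) fun η hη => ?_
    exact pow_le_one₀ (hη.map_X_nonneg _ le_rfl) (hη.map_X_le_one _ le_rfl)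
  refine (Finset.sum_le_sum fun a _ => Finset.sum_le_sum fun u _ => h a u).trans ?_
  simp

end Potential

/-! ### Random prefixes and telescoping -/

section RandomSet

theorem sum_map_uniform {Ω S : Type*} [Fintype Ω] [Nonempty Ω] [Fintype S] [DecidableEq S]
    (f : Ω → S) (F : S → ℝ) :
    ∑ s, (((PMF.uniformOfFintype Ω).map f) s).toReal * F s =
      (Fintype.card Ω : ℝ)⁻¹ * ∑ x, F (f x) := by
  have h : ∀ s, (((PMF.uniformOfFintype Ω).map f) s).toReal =
      ∑ x, if s = f x then (Fintype.card Ω : ℝ)⁻¹ else 0 := by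
    intro s
    rw [PMF.map_apply, tsum_fintype, ENNReal.toReal_sum]
    · refine Finset.sum_congr rfl fun x _ => ?_
      by_cases hx : s = f x <;> simp [hx]
    · intro x _
      split_ifs
      · exact PMF.apply_ne_top _ _
      · exact ENNReal.zero_ne_top
  simp only [h, Finset.sum_mul, ite_mul, zero_mul]
  rw [Finset.sum_comm]
  simp [Finset.mul_sum]

variable {V : Type*} [DecidableEq V] {r : ℕ}

/-- The set of the first `j` entries of `f`. -/
def initialSet (f : Fin r → V) (j : ℕ) : Finset V :=
  (Finset.univ.filter fun i : Fin r => (i : ℕ) < j).image f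

theorem card_initialSet_le (f : Fin r → V) (j : ℕ) : (initialSet f j).card ≤ r := by
  refine Finset.card_image_le.trans ((Finset.card_filter_le _ _).trans ?_)
  simp

theorem initialSet_succ (f : Fin r → V) (j : Fin r) :
    initialSet f (j + 1) = insert (f j) (initialSet f j) := by
  rw [initialSet, initialSet, ← Finset.image_insert]
  congr 1
  ext i
  simp only [Finset.mem_filter, Finset.mem_univ, true_and, Finset.mem_insert, Fin.ext_iff]
  omega

theorem initialSet_update (f : Fin r → V) (j : Fin r) (w : V) :
    initialSet (Function.update f j w) j = initialSet f j := by
  refine Finset.image_congr fun i hi => ?_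
  have hi' : (i : ℕ) < j := by simpa using hi
  exact Function.update_of_ne (by rintro rfl; omega) _ _

variable [Fintype V]

theorem sum_initialSet_succ (Φ : Finset V → ℝ) (j : Fin r) :
    (Fintype.card V : ℝ) * ∑ f : Fin r → V, Φ (initialSet f (j + 1)) =
      ∑ f : Fin r → V, ∑ w, Φ (insert w (initialSet f j)) := by
  -- Exchanging the fresh point `w` with the `j`-th entry of `f` is a bijection that leaves the
  -- first `j` entries alone: the next entry is a uniform extension.
  have h : Function.Involutive fun x : (Fin r → V) × V => (Function.update x.1 j x.2, x.1 j) := by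
    rintro ⟨f, w⟩
    simp
  rw [← Fintype.sum_prod_type' (f := fun (f : Fin r → V) w => Φ (insert w (initialSet f j))),
    ← Equiv.sum_comp h.toPerm, Fintype.sum_prod_type, Finset.mul_sum]
  refine Finset.sum_congr rfl fun f _ => ?_
  simp [initialSet_update, initialSet_succ]

/-- If the average of `Φ` over one-point extensions exceeds `Φ` by `W / |V|`, then `W` is small on
the set of the first `j` entries of a random sequence of length `r`, for random `j < r`. -/
theorem exists_pmf_sum_mul_le [Nonempty V] {K : ℕ} (hr : 0 < r) (hK : r ≤ K) :
    ∃ 𝒯 : PMF {T : Finset V // T.card ≤ K}, (∀ T, 𝒯 T ≠ 0 → T.1.card ≤ r) ∧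
      ∀ (Φ W : Finset V → ℝ) (B : ℝ),
        (∀ T, T.card ≤ r → Fintype.card V * Φ T + W T ≤ ∑ v, Φ (insert v T)) →
        (∀ T, T.card ≤ r → 0 ≤ Φ T) → (∀ T, T.card ≤ r → Φ T ≤ B) →
        ∑ T, (𝒯 T).toReal * W T.1 ≤ Fintype.card V * B / r := by
  have : Nonempty (Fin r) := ⟨⟨0, hr⟩⟩
  refine ⟨(PMF.uniformOfFintype (Fin r × (Fin r → V))).map fun x =>
    ⟨initialSet x.2 x.1, (card_initialSet_le x.2 x.1).trans hK⟩, ?_, ?_⟩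
  · intro T hT
    rw [← PMF.mem_support_iff, PMF.mem_support_map_iff] at hT
    obtain ⟨x, -, rfl⟩ := hT
    exact card_initialSet_le _ _
  · intro Φ W B hW h0 hB
    rw [sum_map_uniform _ fun T : {T : Finset V // T.card ≤ K} => W T.1]
    have hstep : ∀ j : Fin r, ∑ f : Fin r → V, W (initialSet f j) ≤ Fintype.card V *
        (∑ f : Fin r → V, Φ (initialSet f (j + 1)) - ∑ f : Fin r → V, Φ (initialSet f j)) := by
      intro j
      rw [mul_sub, sum_initialSet_succ, Finset.mul_sum, ← Finset.sum_sub_distrib]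
      refine Finset.sum_le_sum fun f _ => ?_
      have := hW _ (card_initialSet_le f j)
      linarith
    -- The steps telescope to `Φ` at length `r` minus `Φ` at length 0, between the bounds `B` and
    -- `0`.
    have htel : ∑ x : Fin r × (Fin r → V), W (initialSet x.2 x.1) ≤
        Fintype.card V * (Fintype.card (Fin r → V) * B) := by
      rw [Fintype.sum_prod_type]
      refine (Finset.sum_le_sum fun j _ => hstep j).trans ?_
      rw [← Finset.mul_sum, Fin.sum_univ_eq_sum_range (fun j => ∑ f : Fin r → V,
        Φ (initialSet f (j + 1)) - ∑ f : Fin r → V, Φ (initialSet f j)), Finset.sum_range_sub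
        (fun j => ∑ f : Fin r → V, Φ (initialSet f j))]
      refine mul_le_mul_of_nonneg_left ?_ (Nat.cast_nonneg _)
      have h1 : ∑ f : Fin r → V, Φ (initialSet f r) ≤ ∑ _f : Fin r → V, B :=
        Finset.sum_le_sum fun f _ => hB _ (card_initialSet_le f r)
      have h2 : 0 ≤ ∑ f : Fin r → V, Φ (initialSet f 0) :=
        Finset.sum_nonneg fun f _ => h0 _ (card_initialSet_le f 0)
      rw [Finset.sum_const, Finset.card_univ, nsmul_eq_mul] at h1
      linarith
    have hr' : (0 : ℝ) < r := by exact_mod_cast hr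
    have hc : (0 : ℝ) < Fintype.card (Fin r → V) := by exact_mod_cast Fintype.card_pos
    rw [Fintype.card_prod, Fintype.card_fin, Nat.cast_mul]
    refine (mul_le_mul_of_nonneg_left htel (by positivity)).trans (le_of_eq ?_)
    field_simp

end RandomSet

/-! ### Concentration and products of frequencies -/

section Averages

variable {V D : Type*} {k : ℕ} {𝓡 : Set (Set (Fin k → D))} {ℓ : ℕ}
  {η : MvPolynomial (V × D) ℝ →ₗ[ℝ] ℝ}

theorem averageMarginal_eq (I : CSPInstance V D k 𝓡) (Q : Finset (Fin k)) (b : Q → D) :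
    averageMarginal I η Q b = η (constraintAverage I Q b) := by
  rw [constraintAverage, map_smul, map_multiset_sum, Multiset.map_map, averageMarginal,
    smul_eq_mul]
  rfl

theorem totalDegree_scopeMonomial_le (σ : Fin k ↪ V) (Q : Finset (Fin k)) (b : Q → D) :
    (scopeMonomial σ Q b).totalDegree ≤ Q.card :=
  (totalDegree_prod_X_le Finset.univ fun i : Q => (σ i, b i)).trans (by simp)

theorem totalDegree_constraintAverage_le (I : CSPInstance V D k 𝓡) (Q : Finset (Fin k))
    (b : Q → D) : (constraintAverage I Q b).totalDegree ≤ Q.card := by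
  rw [← mem_restrictTotalDegree]
  refine Submodule.smul_mem _ _ (multiset_sum_mem _ fun p hp => ?_)
  obtain ⟨c, -, rfl⟩ := Multiset.mem_map.1 hp
  exact (mem_restrictTotalDegree _ _ _).2 (totalDegree_scopeMonomial_le _ _ _)

variable [Fintype V]

theorem totalDegree_tupleAverage_le [DecidableEq V] (Q : Finset (Fin k)) (b : Q → D) :
    (tupleAverage V Q b).totalDegree ≤ Q.card :=
  (totalDegree_smul_le _ _).trans
    (totalDegree_finsetSum_le fun σ _ => totalDegree_scopeMonomial_le σ Q b)

theorem totalDegree_frequency_le (a : D) : (frequency V a).totalDegree ≤ 1 :=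
  (totalDegree_smul_le _ _).trans (totalDegree_finsetSum_le fun v _ => by rw [totalDegree_X])

theorem prod_frequency {ι : Type*} [Fintype ι] [DecidableEq ι] (b : ι → D) :
    ∏ i, frequency V (b i) = ((Fintype.card V : ℝ) ^ Fintype.card ι)⁻¹ •
      ∑ f : ι → V, ∏ i, X (f i, b i) := by
  simp only [frequency, Finset.prod_smul, Finset.prod_const, Finset.card_univ, inv_pow]
  rw [Fintype.prod_sum]

variable [Fintype D]

/-- Soundness bounds the pseudo-expectation of the squared difference by `ε²`, and Cauchy–Schwarz
against 1 removes the square. -/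
theorem IsPseudoDistribution.abs_map_sub_le_of_concentrated [DecidableEq V]
    (hη : IsPseudoDistribution (assignmentSystem V D) ℓ η) {I : CSPInstance V D k 𝓡} {t d : ℕ}
    {ε : ℝ} (hε : 0 ≤ ε) (hI : Concentrated I t ε d) (hd : d ≤ ℓ) (ht : 2 * t ≤ ℓ)
    {Q : Finset (Fin k)} (hQ : Q.card = t) (b : Q → D) :
    |η (constraintAverage I Q b) - η (tupleAverage V Q b)| ≤ ε := by
  have h1 := hη.nonneg_of_sosProof (hI Q hQ b) hd
  have h2 := totalDegree_sub (constraintAverage I Q b) (tupleAverage V Q b)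
  have h3 := totalDegree_constraintAverage_le I Q b
  have h4 := totalDegree_tupleAverage_le (V := V) Q b
  have h5 := hη.sq_map_le (p := constraintAverage I Q b - tupleAverage V Q b) (by omega)
  rw [map_sub, ← mul_one (C (ε ^ 2)), ← smul_eq_C_mul, map_smul, hη.map_one, smul_eq_mul,
    mul_one] at h1
  rw [← map_sub]
  exact abs_le_of_sq_le_sq (by linarith) hε

theorem IsPseudoDistribution.map_prod_frequency_nonneg
    (hη : IsPseudoDistribution (assignmentSystem V D) ℓ η) {ι : Type*} [Fintype ι] (b : ι → D)
    (hι : 2 * Fintype.card ι ≤ ℓ) : 0 ≤ η (∏ i, frequency V (b i)) := by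
  classical
  rw [prod_frequency, map_smul, map_sum, smul_eq_mul]
  exact mul_nonneg (by positivity) (Finset.sum_nonneg fun f _ => hη.map_prod_nonneg _ _ hι)

theorem IsPseudoDistribution.map_prod_frequency_le_one
    (hη : IsPseudoDistribution (assignmentSystem V D) ℓ η) {ι : Type*} [Fintype ι] (b : ι → D)
    (hι : 2 * Fintype.card ι ≤ ℓ) : η (∏ i, frequency V (b i)) ≤ 1 := by
  classical
  rw [prod_frequency, map_smul, map_sum, smul_eq_mul]
  refine (mul_le_mul_of_nonneg_left (Finset.sum_le_sum fun f _ => hη.map_prod_le_one _ _ hι)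
    (by positivity)).trans ?_
  rw [Finset.sum_const, Finset.card_univ, Fintype.card_fun, nsmul_eq_mul, mul_one, Nat.cast_pow]
  exact inv_mul_le_one

/-- Factors are replaced by their means one at a time. Each replacement costs `η ((S - η S) P)`, at
most the standard deviation of `S` because `η (P²) ≤ 1`; multiplying the earlier error by `η S ∈ [0,
1]` does not enlarge it. -/
theorem IsPseudoDistribution.abs_map_prod_frequency_sub_le
    (hη : IsPseudoDistribution (assignmentSystem V D) ℓ η) {ι : Type*} (s : Finset ι) (b : ι → D)
    (hs : 4 * s.card ≤ ℓ) :
    |η (∏ i ∈ s, frequency V (b i)) - ∏ i ∈ s, η (frequency V (b i))| ≤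
      ∑ i ∈ s, √(covariance η (frequency V (b i)) (frequency V (b i))) := by
  classical
  induction s using Finset.induction_on with
  | empty => simp [hη.map_one]
  | insert j s hj ih =>
    rw [Finset.card_insert_of_notMem hj] at hs
    rw [Finset.prod_insert hj, Finset.prod_insert hj, Finset.sum_insert hj]
    set S := frequency V (b j) with hS
    set P := ∏ i ∈ s, frequency V (b i) with hP
    have hSdeg : S.totalDegree ≤ 1 := totalDegree_frequency_le _
    have hPdeg : P.totalDegree ≤ s.card := by
      refine (totalDegree_finsetProd _ _).trans ((Finset.sum_le_sum fun i _ =>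
        totalDegree_frequency_le (b i)).trans (by simp))
    have hS0 : 0 ≤ η S := by
      simpa using hη.map_prod_frequency_nonneg (fun _ : Unit => b j) (by simp; omega)
    have hS1 : η S ≤ 1 := by
      simpa using hη.map_prod_frequency_le_one (fun _ : Unit => b j) (by simp; omega)
    have hP1 : η (P ^ 2) ≤ 1 := by
      -- `P ^ 2` is a product of frequencies over two copies of `s`, whence the factor 4 in the
      -- degree hypothesis.
      have h := hη.map_prod_frequency_le_one (Sum.elim (fun i : s => b i) (fun i : s => b i))
        (by simp; omega)
      rw [Fintype.prod_sum_type] at h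
      simp only [Sum.elim_inl, Sum.elim_inr] at h
      rwa [Finset.prod_coe_sort s fun i => frequency V (b i), ← sq] at h
    have hcs := hη.map_mul_sq_le (p := S - C (η S)) (q := P)
      (by have := totalDegree_sub_C_le S (η S); omega) (by omega)
    have hC : ∀ c : ℝ, ∀ p, η (C c * p) = c * η p := fun c p => by
      rw [← smul_eq_C_mul, map_smul, smul_eq_mul]
    have hvar : η ((S - C (η S)) ^ 2) = covariance η S S := by
      have h : (S - C (η S)) ^ 2 = S * S - C (2 * η S) * S + C (η S ^ 2) * 1 := by
        rw [C_mul, C_pow, show (C 2 : MvPolynomial (V × D) ℝ) = 2 from map_ofNat C 2]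
        ring
      rw [h, map_add, map_sub, hC, hC, hη.map_one, covariance]
      ring
    have hvar0 : 0 ≤ covariance η S S := by
      rw [← hvar]
      exact hη.map_sq_nonneg _ (by have := totalDegree_sub_C_le S (η S); omega)
    have h1 : |η ((S - C (η S)) * P)| ≤ √(covariance η S S) := by
      refine Real.abs_le_sqrt (hcs.trans ?_)
      rw [hvar]
      exact mul_le_of_le_one_right hvar0 hP1
    have h2 : η (S * P) - η S * ∏ i ∈ s, η (frequency V (b i)) = η ((S - C (η S)) * P) +
        η S * (η P - ∏ i ∈ s, η (frequency V (b i))) := by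
      rw [sub_mul, map_sub, hC]
      ring
    rw [h2]
    refine (abs_add_le _ _).trans (add_le_add h1 ?_)
    rw [abs_mul, abs_of_nonneg hS0]
    exact (mul_le_of_le_one_left (abs_nonneg _) hS1).trans (ih (by omega))

end Averages

/-! ### Injections versus arbitrary maps -/

section Collisions

/-- A uniformly random injection restricts to a uniformly random injection. -/
theorem sum_embedding_restrict {V : Type*} [Fintype V] [DecidableEq V] {k : ℕ}
    (Q : Finset (Fin k)) (hk : k ≤ Fintype.card V) (F : (Q ↪ V) → ℝ) :
    (Fintype.card (Fin k ↪ V) : ℝ)⁻¹ * ∑ σ : Fin k ↪ V, F ((Function.Embedding.subtype _).trans σ) =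
      (Fintype.card (Q ↪ V) : ℝ)⁻¹ * ∑ f : Q ↪ V, F f := by
  classical
  -- An injection is its restriction to `Q` plus an injection of the other indices into the unused
  -- values; all fibres have the same size `c`.
  let e : (Fin k ↪ V) ≃ Σ f : Q ↪ V, {i // i ∉ Q} ↪ ↥(Set.range f)ᶜ :=
    ((Equiv.sumCompl (· ∈ Q)).symm.embeddingCongr (Equiv.refl V)).trans
      Equiv.sumEmbeddingEquivSigmaEmbeddingRestricted
  have he : ∀ σ, (e σ).1 = (Function.Embedding.subtype _).trans σ := fun σ => rfl
  set c : ℕ := (Fintype.card V - Q.card).descFactorial (k - Q.card) with hc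
  have hfib : ∀ f : Q ↪ V, Fintype.card ({i // i ∉ Q} ↪ ↥(Set.range f)ᶜ) = c := by
    intro f
    rw [Fintype.card_embedding_eq, Fintype.card_compl_set, Set.card_range_of_injective f.injective,
      Fintype.card_subtype_compl]
    simp [hc]
  have hsum : ∀ G : (Q ↪ V) → ℝ, ∑ σ : Fin k ↪ V, G ((Function.Embedding.subtype _).trans σ) =
      c * ∑ f : Q ↪ V, G f := by
    intro G
    simp only [← he]
    rw [Equiv.sum_comp e (fun x => G x.1), Fintype.sum_sigma, Finset.mul_sum]
    refine Finset.sum_congr rfl fun f _ => ?_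
    dsimp only
    rw [Finset.sum_const, Finset.card_univ, hfib, nsmul_eq_mul]
  have hcard := hsum fun _ => 1
  simp only [Finset.sum_const, Finset.card_univ, nsmul_eq_mul, mul_one] at hcard
  have hc0 : (c : ℝ) ≠ 0 := by
    have hQ : Q.card ≤ k := by simpa using Finset.card_le_univ Q
    have : 0 < c := Nat.descFactorial_pos.2 (by omega)
    positivity
  rw [hsum, hcard, mul_inv]
  field_simp

/-- The averages over all maps and over all injections differ by at most the probability that a
random map is not injective. -/
theorem abs_average_embedding_sub_le {ι V : Type*} [Fintype ι] [DecidableEq ι] [Fintype V]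
    [DecidableEq V] (hι : Fintype.card ι ≤ Fintype.card V) (y : (ι → V) → ℝ)
    (h0 : ∀ f, 0 ≤ y f) (h1 : ∀ f, y f ≤ 1) :
    |(Fintype.card (ι ↪ V) : ℝ)⁻¹ * ∑ f : ι ↪ V, y f -
        ((Fintype.card V : ℝ) ^ Fintype.card ι)⁻¹ * ∑ f, y f| ≤
      1 - (Fintype.card V).descFactorial (Fintype.card ι) /
        (Fintype.card V : ℝ) ^ Fintype.card ι := by
  classical
  have hsub : ∀ G : (ι → V) → ℝ, ∑ f : ι ↪ V, G f =
      ∑ f ∈ Finset.univ.filter (fun f : ι → V => Function.Injective f), G f := by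
    intro G
    rw [← Finset.sum_subtype_eq_sum_filter]
    rw [Finset.subtype_univ]
    exact (Equiv.sum_comp (Equiv.subtypeInjectiveEquivEmbedding ι V) (fun f => G f)).symm
  have hle : ∀ G : (ι → V) → ℝ, (∀ f, 0 ≤ G f) → ∑ f : ι ↪ V, G f ≤ ∑ f, G f := by
    intro G hG
    rw [hsub]
    exact Finset.sum_le_sum_of_subset_of_nonneg (Finset.filter_subset _ _) fun f _ _ => hG f
  rw [← Fintype.card_embedding_eq]
  set m : ℝ := ((Fintype.card (ι ↪ V) : ℕ) : ℝ) with hm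
  set M : ℝ := (Fintype.card V : ℝ) ^ Fintype.card ι with hM
  set A := ∑ f : ι ↪ V, y f
  set B := ∑ f, y f
  have hAB : A ≤ B := hle y h0
  -- Applying the monotonicity to `1 - y` bounds the contribution of the non-injective maps by their
  -- number `M - m`.
  have hBA := hle (fun f => 1 - y f) fun f => sub_nonneg.2 (h1 f)
  simp only [Finset.sum_sub_distrib, Finset.sum_const, Finset.card_univ, nsmul_eq_mul, mul_one,
    Fintype.card_fun, Nat.cast_pow] at hBA
  have hBA' : B ≤ A + (M - m) := by linarith
  have hA0 : 0 ≤ A := Finset.sum_nonneg fun f _ => h0 f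
  have hAm : A ≤ m := by
    calc A ≤ ∑ _f : ι ↪ V, (1 : ℝ) := Finset.sum_le_sum fun f _ => h1 f
      _ = m := by simp only [Finset.sum_const, Finset.card_univ, nsmul_eq_mul, mul_one, hm]
  have hm0 : 0 < m := by
    rw [hm, Fintype.card_embedding_eq]
    exact_mod_cast Nat.descFactorial_pos.2 hι
  have hmM : m ≤ M := by linarith
  have hM0 : 0 < M := hm0.trans_le hmM
  rw [abs_le]
  constructor
  · have h2 : M⁻¹ * B ≤ M⁻¹ * (A + (M - m)) := mul_le_mul_of_nonneg_left hBA' (by positivity)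
    have h3 : M⁻¹ * A ≤ m⁻¹ * A := mul_le_mul_of_nonneg_right (inv_anti₀ hm0 hmM) hA0
    have h4 : M⁻¹ * (A + (M - m)) = M⁻¹ * A + (1 - m / M) := by field_simp
    linarith
  · have h2 : M⁻¹ * A ≤ M⁻¹ * B := mul_le_mul_of_nonneg_left hAB (by positivity)
    have h3 : (m⁻¹ - M⁻¹) * A ≤ (m⁻¹ - M⁻¹) * m :=
      mul_le_mul_of_nonneg_left hAm (sub_nonneg.2 (inv_anti₀ hm0 hmM))
    have h4 : (m⁻¹ - M⁻¹) * m = 1 - m / M := by field_simp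
    linarith

theorem tendsto_descFactorial_div_pow (t : ℕ) :
    Filter.Tendsto (fun n : ℕ => (n.descFactorial t : ℝ) / (n : ℝ) ^ t) Filter.atTop (nhds 1) := by
  induction t with
  | zero => simp
  | succ t ih =>
    have h : Filter.Tendsto (fun n : ℕ => (1 - (t : ℝ) / n) * ((n.descFactorial t : ℝ) / (n : ℝ) ^ t))
        Filter.atTop (nhds ((1 - 0) * 1)) :=
      (tendsto_const_nhds.sub (tendsto_const_div_atTop_nhds_zero_nat (t : ℝ))).mul ih
    rw [sub_zero, one_mul] at h
    refine h.congr' ?_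
    filter_upwards [Filter.eventually_ge_atTop (t + 1)] with n hn
    have hn0 : (n : ℝ) ≠ 0 := by exact_mod_cast (by omega : n ≠ 0)
    rw [Nat.descFactorial_succ, Nat.cast_mul, Nat.cast_sub (by omega)]
    field_simp
    ring

variable {V D : Type*} [Fintype V] [DecidableEq V] [Fintype D] {ℓ k : ℕ}
  {η : MvPolynomial (V × D) ℝ →ₗ[ℝ] ℝ}

theorem IsPseudoDistribution.abs_map_tupleAverage_sub_le
    (hη : IsPseudoDistribution (assignmentSystem V D) ℓ η) (hk : k ≤ Fintype.card V)
    (Q : Finset (Fin k)) (hQ : 2 * Q.card ≤ ℓ) (b : Q → D) :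
    |η (tupleAverage V Q b) - η (∏ i, frequency V (b i))| ≤
      1 - (Fintype.card V).descFactorial Q.card / (Fintype.card V : ℝ) ^ Q.card := by
  have hQk : Q.card ≤ k := by simpa using Finset.card_le_univ Q
  have h := abs_average_embedding_sub_le (ι := Q) (V := V) (by simp; omega)
    (fun f => η (∏ i, X (f i, b i)))
    (fun f => hη.map_prod_nonneg Finset.univ (fun i => (f i, b i)) (by simpa using hQ))
    (fun f => hη.map_prod_le_one Finset.univ (fun i => (f i, b i)) (by simpa using hQ))
  rw [← sum_embedding_restrict Q hk (fun f => η (∏ i, X (f i, b i)))] at h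
  rw [prod_frequency, tupleAverage, map_smul, map_smul, map_sum, map_sum]
  simpa [scopeMonomial] using h

end Collisions

/-! ### The estimate for a single conditioned functional -/

/-- The product error involves standard deviations, whereas the potential controls squared
variances. A bound affine in `x ^ 2` passes through expectations by linearity. -/
theorem sqrt_le_add_sq_div {x δ : ℝ} (hδ : 0 < δ) : √x ≤ δ + x ^ 2 / δ ^ 3 := by
  rcases le_total x 0 with hx | hx
  · rw [Real.sqrt_eq_zero_of_nonpos hx]
    positivity
  rcases le_total (√x) δ with h | h
  · have : 0 ≤ x ^ 2 / δ ^ 3 := by positivity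
    linarith
  · have h1 : √x ≤ x ^ 2 / δ ^ 3 := by
      rw [le_div_iff₀ (by positivity)]
      calc √x * δ ^ 3 ≤ √x * √x ^ 3 := by gcongr
        _ = (√x ^ 2) ^ 2 := by ring
        _ = x ^ 2 := by rw [Real.sq_sqrt hx]
    linarith

theorem pmf_sum_toReal {S : Type*} [Fintype S] (p : PMF S) : ∑ s, (p s).toReal = 1 := by
  rw [← ENNReal.toReal_sum fun s _ => p.apply_ne_top s, ← tsum_fintype (L := .unconditional S), p.tsum_coe,
    ENNReal.toReal_one]

variable {V D : Type*} [Fintype V] {k : ℕ} {𝓡 : Set (Set (Fin k → D))} {ℓ : ℕ}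
  {η : MvPolynomial (V × D) ℝ →ₗ[ℝ] ℝ}

/-- A scope is itself an injection. This is why `N` need not depend on `k`. -/
theorem card_le_of_constraints_ne_zero {I : CSPInstance V D k 𝓡} (hI : I.constraints ≠ 0) :
    k ≤ Fintype.card V := by
  obtain ⟨c, -⟩ := Multiset.exists_mem_of_ne_zero hI
  simpa using Fintype.card_le_of_embedding c.1

variable [DecidableEq V] [Fintype D]

theorem IsPseudoDistribution.productDistance_le
    (hη : IsPseudoDistribution (assignmentSystem V D) ℓ η) {I : CSPInstance V D k 𝓡} {t d : ℕ}
    {ε γ δ : ℝ} (hε : 0 ≤ ε) (hδ : 0 < δ) (hI0 : I.constraints ≠ 0) (hI : Concentrated I t ε d)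
    (hd : d ≤ ℓ) (ht : 4 * t ≤ ℓ)
    (hγ : 1 - (Fintype.card V).descFactorial t / (Fintype.card V : ℝ) ^ t ≤ γ)
    {Q : Finset (Fin k)} (hQ : Q.card = t) :
    productDistance I η Q ≤ (Fintype.card D : ℝ) ^ t * (ε + γ + t * δ) +
      (Fintype.card D : ℝ) ^ t * t / δ ^ 3 *
        ∑ a : D, covariance η (frequency V a) (frequency V a) ^ 2 := by
  set Z := ∑ a : D, covariance η (frequency V a) (frequency V a) ^ 2 with hZ
  have hb : ∀ b : Q → D, |averageMarginal I η Q b - ∏ i : Q, averageVariable η (b i)| ≤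
      ε + γ + t * (δ + Z / δ ^ 3) := by
    intro b
    simp only [averageVariable_eq]
    rw [averageMarginal_eq]
    have h1 := hη.abs_map_sub_le_of_concentrated hε hI hd (by omega) hQ b
    have h2 := hη.abs_map_tupleAverage_sub_le (card_le_of_constraints_ne_zero hI0) Q (by omega) b
    rw [hQ] at h2
    have h3 := hη.abs_map_prod_frequency_sub_le Finset.univ b (by simp [hQ]; omega)
    have h4 : ∑ i : Q, √(covariance η (frequency V (b i)) (frequency V (b i))) ≤
        t * (δ + Z / δ ^ 3) := by
      refine (Finset.sum_le_sum (g := fun _ => δ + Z / δ ^ 3) fun i _ =>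
        (sqrt_le_add_sq_div hδ).trans ?_).trans (by simp [hQ, mul_add])
      have : covariance η (frequency V (b i)) (frequency V (b i)) ^ 2 ≤ Z :=
        Finset.single_le_sum (f := fun a : D => covariance η (frequency V a) (frequency V a) ^ 2)
          (fun a _ => sq_nonneg _) (Finset.mem_univ (b i))
      gcongr
    have h5 := abs_sub_le (η (constraintAverage I Q b)) (η (tupleAverage V Q b))
      (η (∏ i, frequency V (b i)))
    have h6 := abs_sub_le (η (constraintAverage I Q b)) (η (∏ i, frequency V (b i)))
      (∏ i, η (frequency V (b i)))
    linarith
  refine (Finset.sum_le_sum fun b _ => hb b).trans (le_of_eq ?_)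
  rw [Finset.sum_const, Finset.card_univ, Fintype.card_fun, Fintype.card_coe, hQ, nsmul_eq_mul,
    Nat.cast_pow]
  ring

end SoSCSP

/-! ### Choice of constants and conclusion -/

theorem mainTheorem12 {D : Type*} [Fintype D] (ε : ℝ) (hε : 0 < ε) (t : ℕ) :
    ∃ K N : ℕ, ∀ (V : Type*) [Fintype V] [DecidableEq V], N ≤ Fintype.card V →
      ∃ 𝒯 : PMF {T : Finset V // T.card ≤ K},
        ∀ (k : ℕ) (𝓡 : Set (Set (Fin k → D))) (I : SoSCSP.CSPInstance V D k 𝓡) (d : ℕ),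
          I.constraints ≠ 0 →
          SoSCSP.Concentrated I t ε d →
          ∀ μ : MvPolynomial (V × D) ℝ →ₗ[ℝ] ℝ,
            SoSCSP.IsPseudoDistribution (SoSCSP.assignmentSystem V D) (K + d) μ →
            ∀ Q : Finset (Fin k), Q.card = t →
              SoSCSP.conditioningExpectation 𝒯 μ (fun η => SoSCSP.productDistance I η Q)
                ≤ 2 * (Fintype.card D : ℝ) ^ t * ε := by
  set δ : ℝ := ε / (4 * (t + 1)) with hδ
  have hδ0 : 0 < δ := by positivity
  have htδ : t * δ ≤ ε / 4 := by
    rw [hδ, mul_div_assoc', div_le_div_iff₀ (by positivity) (by norm_num)]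
    nlinarith
  set L : ℝ := t / δ ^ 3 * Fintype.card D with hL
  -- The mean variance term is at most `L / r` up to the factor `|D|^t`; the `+ 1` keeps `r`
  -- positive.
  set r : ℕ := ⌈L / (ε / 4)⌉₊ + 1 with hr
  have hr0 : (0 : ℝ) < r := by positivity
  have hLr : L / r ≤ ε / 4 := by
    rw [div_le_comm₀ hr0 (by positivity), hr]
    push_cast
    linarith [Nat.le_ceil (L / (ε / 4))]
  obtain ⟨N, hN⟩ := Filter.eventually_atTop.1
    ((SoSCSP.tendsto_descFactorial_div_pow t).eventually_const_lt
      (show 1 - ε / 2 < 1 by linarith))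
  -- Conditioning on at most `r` variables uses `2 * r` degrees. The product estimate then needs
  -- degree `d + 4 * t`, a potential step degree 4. The `+ 1` forces `V` to be nonempty.
  refine ⟨2 * r + 4 * t + 4, N + 1, fun V _ _ hV => ?_⟩
  have : Nonempty V := Fintype.card_pos_iff.1 (by omega)
  obtain ⟨𝒯, h𝒯, hpot⟩ := SoSCSP.exists_pmf_sum_mul_le (V := V) (r := r) (K := 2 * r + 4 * t + 4)
    (by omega) (by omega)
  refine ⟨𝒯, fun k 𝓡 I d hI0 hI μ hμ Q hQ => ?_⟩
  have hn : (0 : ℝ) < Fintype.card V := by exact_mod_cast Fintype.card_pos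
  have hγ := hN (Fintype.card V) (by omega)
  have hvar := hpot (SoSCSP.potential μ)
    (fun T => (Fintype.card V : ℝ) ^ 2 * SoSCSP.expectedVarianceSq μ T)
    (Fintype.card D * Fintype.card V) (fun T hT => hμ.potential_add_le (by omega))
    (fun T hT => hμ.potential_nonneg (by omega)) (fun T hT => hμ.potential_le (by omega))
  have hvar' : ∑ T, (𝒯 T).toReal * SoSCSP.expectedVarianceSq μ T.1 ≤ Fintype.card D / r := by
    simp only [mul_left_comm _ ((Fintype.card V : ℝ) ^ 2)] at hvar
    rw [← Finset.mul_sum] at hvar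
    refine le_of_mul_le_mul_left (hvar.trans (le_of_eq ?_)) (pow_pos hn 2)
    ring
  set A : ℝ := (Fintype.card D : ℝ) ^ t * (ε + ε / 2 + t * δ) with hA
  set B : ℝ := (Fintype.card D : ℝ) ^ t * t / δ ^ 3 with hB
  have hB0 : 0 ≤ B := by positivity
  have hT : ∀ T, (𝒯 T).toReal * SoSCSP.expectCondition μ T.1
      (fun η => SoSCSP.productDistance I η Q) ≤
      (𝒯 T).toReal * A + B * ((𝒯 T).toReal * SoSCSP.expectedVarianceSq μ T.1) := by
    intro T
    -- Sets in the index type may have up to `K` elements, too many for the degree budget; those in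
    -- the support have at most `r`.
    rcases eq_or_ne (𝒯 T) 0 with h0 | h0
    · simp [h0]
    have hTr := h𝒯 T h0
    rw [mul_left_comm B, ← mul_add]
    refine mul_le_mul_of_nonneg_left ?_ ENNReal.toReal_nonneg
    rw [← hμ.expectCondition_const (T := T.1) (by omega) A, SoSCSP.expectedVarianceSq,
      ← SoSCSP.expectCondition_const_mul, ← SoSCSP.expectCondition_add]
    exact hμ.expectCondition_le (ℓ' := d + 4 * t) (by omega) fun η hη =>
      hη.productDistance_le hε.le hδ0 hI0 hI (by omega) (by omega) (by linarith) hQ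
  calc SoSCSP.conditioningExpectation 𝒯 μ (fun η => SoSCSP.productDistance I η Q)
      ≤ ∑ T, ((𝒯 T).toReal * A + B * ((𝒯 T).toReal * SoSCSP.expectedVarianceSq μ T.1)) :=
        Finset.sum_le_sum fun T _ => hT T
    _ = A + B * ∑ T, (𝒯 T).toReal * SoSCSP.expectedVarianceSq μ T.1 := by
        rw [Finset.sum_add_distrib, ← Finset.sum_mul, ← Finset.mul_sum, SoSCSP.pmf_sum_toReal,
          one_mul]
    _ ≤ A + B * (Fintype.card D / r) := by gcongr
    _ = (Fintype.card D : ℝ) ^ t * (ε + ε / 2 + t * δ + L / r) := by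
        rw [hA, hB, hL]
        ring
    -- The budget is `ε` for concentration, `ε / 2` for collisions, and `ε / 4` each for `t * δ` and
    -- the variance term.
    _ ≤ (Fintype.card D : ℝ) ^ t * (2 * ε) :=
        mul_le_mul_of_nonneg_left (by linarith) (by positivity)
    _ = 2 * (Fintype.card D : ℝ) ^ t * ε := by ring
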